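/- Let $q\in\mathbb{R}\setminus\{0\}$. Let $\mu$ be a probability measure on $\mathbb{R}$ with compact support which is absolutely continuous with respect to Lebesgue measure and whose density is bounded (almost everywhere) by $1/|q|$. Then there exists a unique probability measure $\nu$ on $\mathbb{R}$ with compact support such that $$\exp\Big(-q\sum_{k=0}^{\infty}\mu_k z^{k+1}\Big)=1-q\sum_{k=0}^{\infty}\nu_k z^{k+1}$$ for all $z\in\mathbb{C}$ in some neighbourhood of $0$ (both series converging there), where $\mu_k=\int x^k\,\mu(dx)$ and $\nu_k=\int x^k\,\nu(dx)$ are the moments of $\mu$ and $\nu$. Moreover, the map $MK_{(q)}$ that sends $\mu$ to $\nu$ is a bijection from the set of compactly supported, absolutely continuous probability measures on $\mathbb{R}$ with density bounded by $1/|q|$ onto the set of all compactly supported probability measures on $\mathbb{R}$. -/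

import Mathlib

open MeasureTheory ProbabilityTheory Filter Topology

/-- Probability measures on `ℝ` with compact (topological) support. -/
def CompactProb : Type :=
  {ν : ProbabilityMeasure ℝ // IsCompact (ν : Measure ℝ).support}

/-- Probability measures on `ℝ` with compact support which are absolutely continuous with respect
to Lebesgue measure, with density (Radon-Nikodym derivative) bounded by `1 / |q|` almost
everywhere. -/
def BoundedDensityProb (q : ℝ) : Type :=
  {μ : ProbabilityMeasure ℝ // IsCompact (μ : Measure ℝ).support ∧ (μ : Measure ℝ) ≪ volume ∧
    ∀ᵐ x ∂(volume : Measure ℝ), (μ : Measure ℝ).rnDeriv volume x ≤ ENNReal.ofReal (1 / |q|)}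

/-- The underlying measure. -/
def CompactProb.toMeasure (ν : CompactProb) : Measure ℝ := (ν.1 : Measure ℝ)

/-- The underlying measure. -/
def BoundedDensityProb.toMeasure {q : ℝ} (μ : BoundedDensityProb q) : Measure ℝ :=
  (μ.1 : Measure ℝ)

/-- The `k`-th term `m_k z ^ (k + 1)` of the moment series of a measure on `ℝ`,
where `m_k = ∫ x ^ k` is its `k`-th moment. -/
noncomputable def momentTerm (ρ : Measure ℝ) (z : ℂ) (k : ℕ) : ℂ :=
  ((moment id k ρ : ℝ) : ℂ) * z ^ (k + 1)

/-- The relation `exp (-q ∑ μ_k z ^ (k + 1)) = 1 - q ∑ ν_k z ^ (k + 1)`, as an identity between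
(convergent) power series in a neighbourhood of `z = 0` in `ℂ`. -/
def MarkovKreinRel (q : ℝ) (μ ν : Measure ℝ) : Prop :=
  ∀ᶠ z in 𝓝 (0 : ℂ), Summable (momentTerm μ z) ∧ Summable (momentTerm ν z) ∧
    Complex.exp (-(q : ℂ) * ∑' k, momentTerm μ z k) = 1 - (q : ℂ) * ∑' k, momentTerm ν z k

/-!
The dilation `x ↦ q x` reduces everything to `q = 1`. For `x₁ < ⋯ < xₙ` and `xᵢ ≤ yᵢ ≤ xᵢ₊₁`,
Lebesgue measure on `⋃ [xᵢ, yᵢ)` has the moment series `∑ log ((1 - xᵢ z) / (1 - yᵢ z))`, and the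
partial fraction expansion `∏ (1 - yᵢ z) / (1 - xᵢ z) = 1 - ∑ pᵢ z / (1 - xᵢ z)` exhibits the
corresponding `ν = ∑ pᵢ δ_{xᵢ}`: interlacing makes the residues `pᵢ` nonnegative, and
`∑ pᵢ = ∑ (yᵢ - xᵢ)`. Conversely every choice of positive weights `pᵢ` arises in this way, the `yᵢ`
being roots of a polynomial which changes sign after each `xᵢ`. Rounding to a grid approximates a
measure `μ ≤ volume` by such interval measures and an arbitrary `ν` by such discrete measures, and
weak compactness of the probability measures on a fixed interval produces the missing partner in
the limit. Uniqueness on both sides holds because a compactly supported measure is determined by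
its moments and `exp` is injective near `0`.
-/

/-- The function `x ↦ z / (1 - x z) = ∑ x ^ k z ^ (k + 1)`, whose integral is the moment series. -/
noncomputable def stieltjesKernel (z : ℂ) (x : ℝ) : ℂ := z / (1 - x * z)

/-- The Cauchy–Stieltjes transform `w ↦ ∫ (w - x)⁻¹ ∂ρ` in the variable `z = w⁻¹`, which is the
closed form of the moment series `∑ m_k z ^ (k + 1)`. -/
noncomputable def stieltjesTransform (ρ : Measure ℝ) (z : ℂ) : ℂ := ∫ x, stieltjesKernel z x ∂ρ

section Kernel

variable {R x y : ℝ} {z : ℂ}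

lemma norm_ofReal_mul_le (hx : |x| ≤ R) : ‖(x : ℂ) * z‖ ≤ ‖z‖ * R := by
  rw [norm_mul, Complex.norm_real, Real.norm_eq_abs, mul_comm]
  gcongr

lemma one_sub_ofReal_mul_mem_slitPlane (hx : |x| ≤ R) (hz : ‖z‖ * R < 1) :
    1 - (x : ℂ) * z ∈ Complex.slitPlane := by
  rw [sub_eq_add_neg]
  apply Complex.mem_slitPlane_of_norm_lt_one
  rw [norm_neg]
  exact (norm_ofReal_mul_le hx).trans_lt hz

lemma one_sub_ofReal_mul_ne_zero (hx : |x| ≤ R) (hz : ‖z‖ * R < 1) : 1 - (x : ℂ) * z ≠ 0 :=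
  Complex.slitPlane_ne_zero (one_sub_ofReal_mul_mem_slitPlane hx hz)

lemma measurable_stieltjesKernel (z : ℂ) : Measurable (stieltjesKernel z) := by
  unfold stieltjesKernel
  fun_prop

lemma continuousOn_stieltjesKernel (hz : ‖z‖ * R < 1) :
    ContinuousOn (stieltjesKernel z) (Set.Icc (-R) R) :=
  ContinuousOn.div (by fun_prop) (by fun_prop) fun _ hx =>
    one_sub_ofReal_mul_ne_zero (abs_le.2 hx) hz

lemma norm_stieltjesKernel_le (hx : |x| ≤ R) (hz : ‖z‖ * R < 1) :
    ‖stieltjesKernel z x‖ ≤ ‖z‖ / (1 - ‖z‖ * R) := by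
  have hden : 1 - ‖z‖ * R ≤ ‖1 - (x : ℂ) * z‖ := by
    have := norm_sub_norm_le (1 : ℂ) (x * z)
    rw [norm_one] at this
    linarith [norm_ofReal_mul_le (z := z) hx]
  rw [stieltjesKernel, norm_div]
  exact div_le_div_of_nonneg_left (norm_nonneg z) (by linarith) hden

lemma norm_stieltjesKernel_sub_le (hx : |x| ≤ R) (hy : |y| ≤ R) (hz : ‖z‖ * R < 1) :
    ‖stieltjesKernel z x - stieltjesKernel z y‖ ≤ (‖z‖ / (1 - ‖z‖ * R)) ^ 2 * |x - y| := by
  have resolvent_identity : stieltjesKernel z x - stieltjesKernel z y =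
      stieltjesKernel z x * stieltjesKernel z y * ((x - y : ℝ) : ℂ) := by
    have hx0 := one_sub_ofReal_mul_ne_zero hx hz
    have hy0 := one_sub_ofReal_mul_ne_zero hy hz
    simp only [stieltjesKernel]
    rw [div_sub_div _ _ hx0 hy0, div_mul_div_comm, div_mul_eq_mul_div]
    push_cast
    congr 1
    ring
  rw [resolvent_identity, norm_mul, norm_mul, Complex.norm_real, Real.norm_eq_abs, sq]
  have hx' := norm_stieltjesKernel_le hx hz
  have hy' := norm_stieltjesKernel_le hy hz
  gcongr

end Kernel

section Transform

variable {ρ : Measure ℝ} [IsFiniteMeasure ρ] {R : ℝ} {z : ℂ}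

lemma integrable_stieltjesKernel (hρ : ∀ᵐ x ∂ρ, |x| ≤ R) (hz : ‖z‖ * R < 1) :
    Integrable (stieltjesKernel z) ρ :=
  Integrable.of_bound (measurable_stieltjesKernel z).aestronglyMeasurable _
    (hρ.mono fun _ hx => norm_stieltjesKernel_le hx hz)

lemma hasSum_momentTerm (hρ : ∀ᵐ x ∂ρ, |x| ≤ R) (hR : 0 ≤ R) (hz : ‖z‖ * R < 1) :
    HasSum (momentTerm ρ z) (stieltjesTransform ρ z) := by
  have term_le : ∀ k : ℕ, ∀ᵐ x : ℝ ∂ρ, ‖(x * z) ^ k * z‖ ≤ (‖z‖ * R) ^ k * ‖z‖ := by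
    intro k
    filter_upwards [hρ] with x hx
    rw [norm_mul, norm_pow]
    gcongr
    exact norm_ofReal_mul_le hx
  have summable_bound : Summable fun k : ℕ => (‖z‖ * R) ^ k * ‖z‖ :=
    (summable_geometric_of_lt_one (by positivity) hz).mul_right _
  have geometric : ∀ᵐ x : ℝ ∂ρ, HasSum (fun k => (x * z) ^ k * z) (stieltjesKernel z x) := by
    filter_upwards [hρ] with x hx
    rw [stieltjesKernel, div_eq_inv_mul]
    exact (hasSum_geometric_of_norm_lt_one ((norm_ofReal_mul_le hx).trans_lt hz)).mul_right z
  have integral_term : ∀ k : ℕ, ∫ x : ℝ, (x * z) ^ k * z ∂ρ = momentTerm ρ z k := by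
    intro k
    simp_rw [mul_pow, mul_assoc, ← pow_succ]
    rw [integral_mul_const, momentTerm, moment, ← integral_complex_ofReal]
    simp
  simp only [← funext integral_term]
  exact hasSum_integral_of_dominated_convergence _
    (fun k => (by fun_prop : Measurable fun x : ℝ => (x * z) ^ k * z).aestronglyMeasurable) term_le
    (.of_forall fun _ => summable_bound) (integrable_const _) geometric

lemma ae_map_abs_le_iff {α : Type*} {_ : MeasurableSpace α} {μ : Measure α} {f : α → ℝ}
    (hf : Measurable f) : (∀ᵐ x ∂μ.map f, |x| ≤ R) ↔ ∀ᵐ x ∂μ, |f x| ≤ R :=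
  ae_map_iff hf.aemeasurable (measurableSet_le measurable_norm measurable_const)

lemma norm_stieltjesTransform_map_sub_le {f : ℝ → ℝ} {δ : ℝ} (hf : Measurable f)
    (hρ : ∀ᵐ x ∂ρ, |x| ≤ R) (hfR : ∀ᵐ x ∂ρ, |f x| ≤ R) (hδ : ∀ᵐ x ∂ρ, |f x - x| ≤ δ)
    (hz : ‖z‖ * R < 1) :
    ‖stieltjesTransform (ρ.map f) z - stieltjesTransform ρ z‖ ≤
      (‖z‖ / (1 - ‖z‖ * R)) ^ 2 * δ * ρ.real Set.univ := by
  have hint : Integrable (fun x => stieltjesKernel z (f x)) ρ :=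
    (integrable_stieltjesKernel ((ae_map_abs_le_iff hf).2 hfR) hz).comp_measurable hf
  rw [stieltjesTransform, stieltjesTransform, integral_map hf.aemeasurable
    (measurable_stieltjesKernel z).aestronglyMeasurable, ← integral_sub hint
    (integrable_stieltjesKernel hρ hz)]
  refine norm_integral_le_of_norm_le_const ?_
  filter_upwards [hρ, hfR, hδ] with x hx hfx hxδ
  exact (norm_stieltjesKernel_sub_le hfx hx hz).trans (by gcongr)

end Transform

section Uniqueness

lemma exists_ae_abs_le_of_isCompact_support {ρ : Measure ℝ} (h : IsCompact ρ.support) :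
    ∃ R, 0 ≤ R ∧ ∀ᵐ x ∂ρ, |x| ≤ R := by
  obtain ⟨R, hR, hsub⟩ := h.isBounded.exists_pos_norm_le
  exact ⟨R, hR.le, mem_of_superset ρ.support_mem_ae hsub⟩

lemma isCompact_support_of_ae_abs_le {ρ : Measure ℝ} {R : ℝ} (h : ∀ᵐ x ∂ρ, |x| ≤ R) :
    IsCompact ρ.support :=
  isCompact_Icc.of_isClosed_subset ρ.isClosed_support <|
    Measure.support_subset_of_isClosed isClosed_Icc <| h.mono fun _ => abs_le.1

lemma eventually_norm_mul_lt_one (R : ℝ) : ∀ᶠ z : ℂ in 𝓝 0, ‖z‖ * R < 1 := by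
  have : Tendsto (fun z : ℂ => ‖z‖ * R) (𝓝 0) (𝓝 0) :=
    Continuous.tendsto' (by fun_prop) _ _ (by simp)
  exact this.eventually_lt_const one_pos

lemma iteratedDeriv_complexMGF_zero {Ω : Type*} {mΩ : MeasurableSpace Ω} {P : Measure Ω}
    {X : Ω → ℝ} (h : 0 ∈ interior (integrableExpSet X P)) (k : ℕ) :
    iteratedDeriv k (complexMGF X P) 0 = (moment X k P : ℝ) := by
  rw [iteratedDeriv_complexMGF (by simpa using h), moment, ← integral_complex_ofReal]
  simp

variable {ρ σ : Measure ℝ} [IsFiniteMeasure ρ] [IsFiniteMeasure σ]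

lemma eventually_hasSum_momentTerm (hρ : IsCompact ρ.support) :
    ∀ᶠ z in 𝓝 0, HasSum (momentTerm ρ z) (stieltjesTransform ρ z) := by
  obtain ⟨R, hR, hρR⟩ := exists_ae_abs_le_of_isCompact_support hρ
  exact (eventually_norm_mul_lt_one R).mono fun z => hasSum_momentTerm hρR hR

lemma hasFPowerSeriesAt_stieltjesTransform (hρ : IsCompact ρ.support) :
    HasFPowerSeriesAt (stieltjesTransform ρ) (FormalMultilinearSeries.ofScalars ℂ
      fun k => if k = 0 then 0 else ((moment id (k - 1) ρ : ℝ) : ℂ)) 0 := by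
  rw [hasFPowerSeriesAt_iff]
  filter_upwards [eventually_hasSum_momentTerm hρ] with z hz
  rw [zero_add, ← hasSum_nat_add_iff' 1]
  convert! hz using 1
  · ext k
    simp [momentTerm, mul_comm]
  · simp

lemma tendsto_stieltjesTransform_zero (hρ : IsCompact ρ.support) :
    Tendsto (stieltjesTransform ρ) (𝓝 0) (𝓝 0) := by
  have := (hasFPowerSeriesAt_stieltjesTransform hρ).continuousAt
  simpa [ContinuousAt, stieltjesTransform, stieltjesKernel] using this

lemma integrableExpSet_eq_univ_of_isCompact_support (hρ : IsCompact ρ.support) :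
    integrableExpSet id ρ = Set.univ := by
  obtain ⟨R, -, hρR⟩ := exists_ae_abs_le_of_isCompact_support hρ
  exact Set.eq_univ_of_forall fun t =>
    integrable_exp_mul_of_mem_Icc aemeasurable_id (hρR.mono fun _ => abs_le.1)

lemma ext_of_moment_eq (hρ : IsCompact ρ.support) (hσ : IsCompact σ.support)
    (h : ∀ k, moment id k ρ = moment id k σ) : ρ = σ := by
  have analytic : ∀ {τ : Measure ℝ} [IsFiniteMeasure τ], IsCompact τ.support →
      AnalyticOnNhd ℂ (complexMGF id τ) Set.univ := fun {τ} _ hτ => by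
    simpa [integrableExpSet_eq_univ_of_isCompact_support hτ] using
      analyticOnNhd_complexMGF (X := id) (μ := τ)
  suffices complexMGF id ρ =ᶠ[𝓝 0] complexMGF id σ from
    Measure.ext_of_complexMGF_id_eq ((analytic hρ).eq_of_eventuallyEq (analytic hσ) this)
  have series_eq := (analytic hρ 0 trivial).hasFPowerSeriesAt
  simp only [iteratedDeriv_complexMGF_zero, integrableExpSet_eq_univ_of_isCompact_support hρ,
    interior_univ, Set.mem_univ, h] at series_eq
  have series_eq' := (analytic hσ 0 trivial).hasFPowerSeriesAt
  simp only [iteratedDeriv_complexMGF_zero, integrableExpSet_eq_univ_of_isCompact_support hσ,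
    interior_univ, Set.mem_univ] at series_eq'
  filter_upwards [hasFPowerSeriesAt_iff.1 series_eq, hasFPowerSeriesAt_iff.1 series_eq']
    with z hz hz'
  rw [zero_add] at hz hz'
  exact hz.unique hz'

lemma ext_of_stieltjesTransform_eventuallyEq (hρ : IsCompact ρ.support) (hσ : IsCompact σ.support)
    (h : stieltjesTransform ρ =ᶠ[𝓝 0] stieltjesTransform σ) : ρ = σ := by
  refine ext_of_moment_eq hρ hσ fun k => ?_
  have coeff_eq := congrArg (fun p => p.coeff (k + 1)) <|
    ((hasFPowerSeriesAt_stieltjesTransform hρ).congr h).eq_formalMultilinearSeries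
      (hasFPowerSeriesAt_stieltjesTransform hσ)
  simpa [FormalMultilinearSeries.coeff_ofScalars] using coeff_eq

variable {q : ℝ} {μ ν : Measure ℝ} [IsFiniteMeasure μ] [IsFiniteMeasure ν]

lemma markovKreinRel_iff (hμ : IsCompact μ.support) (hν : IsCompact ν.support) :
    MarkovKreinRel q μ ν ↔ ∀ᶠ z in 𝓝 (0 : ℂ),
      Complex.exp (-(q : ℂ) * stieltjesTransform μ z) = 1 - (q : ℂ) * stieltjesTransform ν z := by
  refine eventually_congr ?_
  filter_upwards [eventually_hasSum_momentTerm hμ, eventually_hasSum_momentTerm hν] with z hμz hνz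
  rw [hμz.tsum_eq, hνz.tsum_eq, and_iff_right hμz.summable, and_iff_right hνz.summable]

lemma MarkovKreinRel.right_unique (hq : q ≠ 0) (hμ : IsCompact μ.support)
    (hρ : IsCompact ρ.support) (hσ : IsCompact σ.support) (h : MarkovKreinRel q μ ρ)
    (h' : MarkovKreinRel q μ σ) : ρ = σ := by
  rw [markovKreinRel_iff hμ hρ] at h
  rw [markovKreinRel_iff hμ hσ] at h'
  refine ext_of_stieltjesTransform_eventuallyEq hρ hσ ?_
  filter_upwards [h, h'] with z hz hz'
  exact mul_left_cancel₀ (Complex.ofReal_ne_zero.2 hq) (sub_right_injective (hz.symm.trans hz'))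

lemma eventually_log_exp_mul_stieltjesTransform (c : ℂ) (hρ : IsCompact ρ.support) :
    ∀ᶠ z in 𝓝 (0 : ℂ),
      Complex.log (Complex.exp (c * stieltjesTransform ρ z)) = c * stieltjesTransform ρ z := by
  have im_tendsto : Tendsto (fun z => (c * stieltjesTransform ρ z).im) (𝓝 0) (𝓝 0) := by
    have := (tendsto_stieltjesTransform_zero hρ).const_mul c
    rw [mul_zero] at this
    exact (Complex.continuous_im.tendsto' 0 0 Complex.zero_im).comp this
  filter_upwards [im_tendsto.eventually_lt_const Real.pi_pos,
    im_tendsto.eventually_const_lt (neg_lt_zero.2 Real.pi_pos)] with z hlt hgt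
  exact Complex.log_exp hgt hlt.le

lemma MarkovKreinRel.left_unique (hq : q ≠ 0) (hρ : IsCompact ρ.support)
    (hσ : IsCompact σ.support) (hν : IsCompact ν.support) (h : MarkovKreinRel q ρ ν)
    (h' : MarkovKreinRel q σ ν) : ρ = σ := by
  rw [markovKreinRel_iff hρ hν] at h
  rw [markovKreinRel_iff hσ hν] at h'
  refine ext_of_stieltjesTransform_eventuallyEq hρ hσ ?_
  filter_upwards [h, h', eventually_log_exp_mul_stieltjesTransform (-q) hρ,
    eventually_log_exp_mul_stieltjesTransform (-q) hσ] with z hz hz' hlog hlog'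
  refine mul_left_cancel₀ (neg_ne_zero.2 (Complex.ofReal_ne_zero.2 hq)) ?_
  rw [← hlog, ← hlog', hz, hz']

end Uniqueness

section WeakLimits

lemma exists_subseq_tendsto_of_ae_mem {E : Type*} [MetricSpace E]
    [TopologicalSpace.SeparableSpace E] [MeasurableSpace E] [BorelSpace E] {K : Set E}
    (hK : IsCompact K) (μ : ℕ → ProbabilityMeasure E) (hμ : ∀ n, ∀ᵐ x ∂(μ n : Measure E), x ∈ K) :
    ∃ (σ : ProbabilityMeasure E) (φ : ℕ → ℕ), StrictMono φ ∧ Tendsto (μ ∘ φ) atTop (𝓝 σ) ∧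
      ∀ᵐ x ∂(σ : Measure E), x ∈ K := by
  have compact := isCompact_setOfPred_probabilityMeasure_mass_eq_compl_isCompact_le
    (u := fun _ => 0) (K := fun _ => K) tendsto_const_nhds (fun _ => hK) (Or.inr monotone_const)
  obtain ⟨σ, hσ, φ, hφ, hlim⟩ := compact.tendsto_subseq (x := μ) fun n _ =>
    ((μ n).null_iff_toMeasure_null Kᶜ |>.2 (hμ n)).le
  exact ⟨σ, φ, hφ, hlim, (σ.null_iff_toMeasure_null _).1 (le_zero_iff.1 (hσ 0))⟩

variable {ι : Type*} {L : Filter ι}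

lemma tendsto_integral_of_continuousOn_Icc {𝕜 : Type*} [RCLike 𝕜] {a b : ℝ}
    {μ : ι → ProbabilityMeasure ℝ} {σ : ProbabilityMeasure ℝ} {f : ℝ → 𝕜}
    (hf : ContinuousOn f (Set.Icc a b)) (hlim : Tendsto μ L (𝓝 σ))
    (hμ : ∀ i, ∀ᵐ x ∂(μ i : Measure ℝ), x ∈ Set.Icc a b)
    (hσ : ∀ᵐ x ∂(σ : Measure ℝ), x ∈ Set.Icc a b) :
    Tendsto (fun i => ∫ x, f x ∂(μ i : Measure ℝ)) L (𝓝 (∫ x, f x ∂(σ : Measure ℝ))) := by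
  obtain ⟨x₀, hx₀⟩ := hσ.exists
  have hab : a ≤ b := hx₀.1.trans hx₀.2
  let g : BoundedContinuousFunction ℝ 𝕜 :=
    (BoundedContinuousFunction.mkOfCompact ⟨_, hf.domRestrict⟩).compContinuous
      ⟨Set.projIcc a b hab, continuous_projIcc⟩
  have integral_g : ∀ τ : Measure ℝ, (∀ᵐ x ∂τ, x ∈ Set.Icc a b) → ∫ x, g x ∂τ = ∫ x, f x ∂τ :=
    fun τ hτ => integral_congr_ae <| hτ.mono fun x hx => by simp [g, Set.projIcc_of_mem hab hx]
  have := (ProbabilityMeasure.tendsto_iff_forall_integral_rclike_tendsto 𝕜).1 hlim g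
  simpa only [integral_g _ hσ, integral_g _ (hμ _)] using this

lemma tendsto_stieltjesTransform {μ : ι → ProbabilityMeasure ℝ} {σ : ProbabilityMeasure ℝ} {R : ℝ}
    {z : ℂ} (hlim : Tendsto μ L (𝓝 σ)) (hμ : ∀ i, ∀ᵐ x ∂(μ i : Measure ℝ), |x| ≤ R)
    (hσ : ∀ᵐ x ∂(σ : Measure ℝ), |x| ≤ R) (hz : ‖z‖ * R < 1) :
    Tendsto (fun i => stieltjesTransform (μ i) z) L (𝓝 (stieltjesTransform σ z)) := by
  simp only [abs_le, ← Set.mem_Icc] at hμ hσ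
  exact tendsto_integral_of_continuousOn_Icc (continuousOn_stieltjesKernel hz) hlim hμ hσ

lemma le_of_tendsto_probabilityMeasure {E : Type*} [TopologicalSpace E] [MeasurableSpace E]
    [OpensMeasurableSpace E] [HasOuterApproxClosed E] [L.NeBot] {μ : ι → ProbabilityMeasure E}
    {σ : ProbabilityMeasure E} {τ : Measure E} [τ.OuterRegular] (hlim : Tendsto μ L (𝓝 σ))
    (hμ : ∀ i, (μ i : Measure E) ≤ τ) : (σ : Measure E) ≤ τ := by
  have le_of_isOpen : ∀ U : Set E, IsOpen U → (σ : Measure E) U ≤ τ U := fun U hU =>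
    (ProbabilityMeasure.le_liminf_measure_open_of_tendsto hlim hU).trans <|
      (liminf_le_liminf (.of_forall fun i => hμ i U)).trans (liminf_const _).le
  refine Measure.le_iff.2 fun A _ => ?_
  rw [Set.measure_eq_iInf_isOpen A τ]
  exact le_iInf₂ fun U hAU => le_iInf fun hU => (measure_mono hAU).trans (le_of_isOpen U hU)

end WeakLimits

section PartialFractions

variable {ι F : Type*} [Field F] {s : Finset ι} {v y : ι → F}

lemma degree_nodal_sub_nodal_lt :
    (Lagrange.nodal s v - Lagrange.nodal s y).degree < s.card := by
  rw [← Lagrange.degree_nodal (R := F) (v := v)]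
  refine Polynomial.degree_sub_lt_left (by simp) Lagrange.nodal_ne_zero ?_
  rw [Lagrange.nodal_monic.leadingCoeff, Lagrange.nodal_monic.leadingCoeff]

variable [DecidableEq ι]

/-- The coefficient of `(w - v i)⁻¹` in the partial fraction decomposition of
`1 - ∏ j ∈ s, (w - y j) / (w - v j)`. -/
noncomputable def nodeResidue (s : Finset ι) (v y : ι → F) (i : ι) : F :=
  -(Lagrange.nodalWeight s v i * (Lagrange.nodal s y).eval (v i))

lemma nodeResidue_eq_nodalWeight_mul_eval_sub {i : ι} (hi : i ∈ s) :
    nodeResidue s v y i = Lagrange.nodalWeight s v i *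
      (Lagrange.nodal s v - Lagrange.nodal s y).eval (v i) := by
  rw [nodeResidue, Polynomial.eval_sub, Lagrange.eval_nodal_at_node hi, zero_sub, mul_neg]

lemma prod_sub_div_sub_eq_one_sub_sum_nodeResidue (hv : Set.InjOn v s) {w : F}
    (hw : ∀ i ∈ s, w ≠ v i) :
    ∏ i ∈ s, (w - y i) / (w - v i) = 1 - ∑ i ∈ s, nodeResidue s v y i / (w - v i) := by
  have hw0 : (Lagrange.nodal s v).eval w ≠ 0 := Lagrange.eval_nodal_not_at_node hw
  have interpolation := congrArg (Polynomial.eval w)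
    (Lagrange.eq_interpolate hv (degree_nodal_sub_nodal_lt (v := v) (y := y)))
  rw [Lagrange.eval_interpolate_not_at_node _ hw, Polynomial.eval_sub, mul_comm,
    ← div_eq_iff hw0, sub_div, div_self hw0] at interpolation
  rw [Finset.prod_div_distrib, ← Lagrange.eval_nodal, ← Lagrange.eval_nodal,
    eq_sub_iff_add_eq', ← eq_sub_iff_add_eq, interpolation]
  refine Finset.sum_congr rfl fun i hi => ?_
  rw [nodeResidue_eq_nodalWeight_mul_eval_sub hi, mul_right_comm, div_eq_mul_inv]

lemma sum_nodeResidue (hv : Set.InjOn v s) :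
    ∑ i ∈ s, nodeResidue s v y i = ∑ i ∈ s, (y i - v i) := by
  rcases s.eq_empty_or_nonempty with rfl | hs
  · simp
  have leading_coeff := Lagrange.coeff_eq_sum hv (degree_nodal_sub_nodal_lt (v := v) (y := y))
  rw [Polynomial.coeff_sub, Lagrange.nodal_eq, Lagrange.nodal_eq,
    Polynomial.prod_X_sub_C_coeff_card_pred _ _ hs.card_pos,
    Polynomial.prod_X_sub_C_coeff_card_pred _ _ hs.card_pos] at leading_coeff
  rw [Finset.sum_sub_distrib, ← neg_sub_neg, leading_coeff]
  refine Finset.sum_congr rfl fun i hi => ?_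
  rw [nodeResidue_eq_nodalWeight_mul_eval_sub hi, Lagrange.nodalWeight, Finset.prod_inv_distrib,
    inv_mul_eq_div, Lagrange.nodal_eq, Lagrange.nodal_eq]

end PartialFractions

lemma one_sub_sum_nodeResidue_mul_stieltjesKernel {s : Finset ℝ} (y : ℝ → ℝ) {z : ℂ}
    (hz : ∀ x ∈ s, 1 - (x : ℂ) * z ≠ 0) :
    1 - ∑ x ∈ s, ((nodeResidue s id y x : ℝ) : ℂ) * stieltjesKernel z x =
      ∏ x ∈ s, (1 - (y x : ℂ) * z) / (1 - (x : ℂ) * z) := by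
  rcases eq_or_ne z 0 with rfl | hz0
  · simp [stieltjesKernel]
  have inv_sub_eq (a : ℝ) : z⁻¹ - a = (1 - a * z) / z := by field_simp
  have residue_eq (x : ℝ) : ((nodeResidue s id y x : ℝ) : ℂ) =
      nodeResidue s Complex.ofReal (fun t => (y t : ℂ)) x := by
    simp [nodeResidue, Lagrange.nodalWeight, Lagrange.eval_nodal]
  have partial_fractions := prod_sub_div_sub_eq_one_sub_sum_nodeResidue
    (y := fun t => (y t : ℂ)) (Complex.ofReal_injective.injOn (s := s)) (w := z⁻¹)
    fun x hx h => hz x hx (by rw [← h, inv_mul_cancel₀ hz0, sub_self])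
  simp only [inv_sub_eq, div_div_div_cancel_right₀ hz0] at partial_fractions
  rw [partial_fractions]
  simp only [residue_eq, stieltjesKernel, div_div_eq_mul_div, mul_div_assoc]

/-- Each `y x` lies between the node `x` and the next node of `s`. -/
def Interlaces (s : Finset ℝ) (y : ℝ → ℝ) : Prop :=
  ∀ x ∈ s, x ≤ y x ∧ ∀ x' ∈ s, x < x' → y x ≤ x'

/-- The monic polynomial `(1 - ∑ x ∈ s, p x / (X - x)) * ∏ x ∈ s, (X - x)`, written as a Lagrange
interpolant. If its roots are `y x`, `x ∈ s`, then `p` is the residue function of `y`. -/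
noncomputable def secularPolynomial (s : Finset ℝ) (p : ℝ → ℝ) : Polynomial ℝ :=
  Lagrange.nodal s id - Lagrange.interpolate s id fun x => p x / Lagrange.nodalWeight s id x

section Interlacing

variable {s : Finset ℝ} {p y : ℝ → ℝ} {x : ℝ}

lemma Interlaces.nodeResidue_nonneg (h : Interlaces s y) (hx : x ∈ s) :
    0 ≤ nodeResidue s id y x := by
  rw [nodeResidue, Lagrange.nodalWeight, Lagrange.eval_nodal, ← Finset.mul_prod_erase s _ hx,
    mul_left_comm, ← neg_mul, ← Finset.prod_mul_distrib]
  refine mul_nonneg (by simpa using (h x hx).1) (Finset.prod_nonneg fun t ht => ?_)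
  obtain ⟨hne, hts⟩ := Finset.mem_erase.1 ht
  rw [inv_mul_eq_div]
  rcases lt_or_gt_of_ne hne with hlt | hgt
  · exact div_nonneg (sub_nonneg.2 ((h t hts).2 x hx hlt)) (sub_nonneg.2 hlt.le)
  · exact div_nonneg_of_nonpos (sub_nonpos.2 (hgt.le.trans (h t hts).1)) (sub_nonpos.2 hgt.le)

lemma Interlaces.pairwiseDisjoint_Ico (h : Interlaces s y) :
    (s : Set ℝ).PairwiseDisjoint fun x => Set.Ico x (y x) := by
  intro a ha b hb hab
  rw [Function.onFun, Set.disjoint_left]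
  rintro t ⟨hat, hta⟩ ⟨hbt, htb⟩
  rcases lt_or_gt_of_ne hab with hlt | hgt
  · exact (hta.trans_le ((h a ha).2 b hb hlt)).not_ge hbt
  · exact (htb.trans_le ((h b hb).2 a ha hgt)).not_ge hat

lemma Interlaces.le_add_of_sum_sub_le (h : Interlaces s y) {c : ℝ} (hsum : ∑ x ∈ s, (y x - x) ≤ c)
    (hx : x ∈ s) : y x ≤ x + c := by
  have := Finset.single_le_sum (f := fun x => y x - x) (fun t ht => sub_nonneg.2 (h t ht).1) hx
  linarith

lemma degree_interpolate_lt_degree_nodal (s : Finset ℝ) (r : ℝ → ℝ) :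
    (Lagrange.interpolate s id r).degree < (Lagrange.nodal s (id : ℝ → ℝ)).degree := by
  rw [Lagrange.degree_nodal]
  exact Lagrange.degree_interpolate_lt _ Function.injective_id.injOn

lemma monic_secularPolynomial (s : Finset ℝ) (p : ℝ → ℝ) : (secularPolynomial s p).Monic :=
  Lagrange.nodal_monic.sub_of_left (degree_interpolate_lt_degree_nodal s _)

lemma degree_secularPolynomial (s : Finset ℝ) (p : ℝ → ℝ) :
    (secularPolynomial s p).degree = s.card := by
  rw [secularPolynomial, Polynomial.degree_sub_eq_left_of_degree_lt
    (degree_interpolate_lt_degree_nodal s _), Lagrange.degree_nodal]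

lemma eval_secularPolynomial_node (hx : x ∈ s) :
    (secularPolynomial s p).eval x = -(p x / Lagrange.nodalWeight s id x) := by
  have nodal_eq := Lagrange.eval_nodal_at_node (v := (id : ℝ → ℝ)) hx
  have interpolate_eq := Lagrange.eval_interpolate_at_node
    (fun t => p t / Lagrange.nodalWeight s id t) Function.injective_id.injOn hx
  rw [id] at nodal_eq interpolate_eq
  rw [secularPolynomial, Polynomial.eval_sub, nodal_eq, interpolate_eq, zero_sub]

lemma nodeResidue_eq_of_secularPolynomial_eq_nodal (h : secularPolynomial s p = Lagrange.nodal s y)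
    (hx : x ∈ s) : nodeResidue s id y x = p x := by
  rw [nodeResidue, ← h, id, eval_secularPolynomial_node hx, mul_neg, neg_neg, mul_div_cancel₀]
  exact Lagrange.nodalWeight_ne_zero Function.injective_id.injOn hx

lemma nodalWeight_pos_of_forall_le (hmax : ∀ t ∈ s, t ≤ x) : 0 < Lagrange.nodalWeight s id x :=
  Finset.prod_pos fun t ht => inv_pos.2 <| sub_pos.2 <|
    (hmax t (Finset.mem_of_mem_erase ht)).lt_of_ne (Finset.ne_of_mem_erase ht)

lemma nodalWeight_mul_nodalWeight_neg {x' : ℝ} (hx : x ∈ s) (hx' : x' ∈ s) (hlt : x < x')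
    (hnext : ∀ t ∈ s, x < t → x' ≤ t) :
    Lagrange.nodalWeight s id x * Lagrange.nodalWeight s id x' < 0 := by
  rw [Lagrange.nodalWeight, Lagrange.nodalWeight,
    ← Finset.mul_prod_erase _ _ (Finset.mem_erase.2 ⟨hlt.ne', hx'⟩),
    ← Finset.mul_prod_erase _ _ (Finset.mem_erase.2 ⟨hlt.ne, hx⟩),
    Finset.erase_right_comm (a := x'), mul_mul_mul_comm, ← Finset.prod_mul_distrib]
  refine mul_neg_of_neg_of_pos (mul_neg_of_neg_of_pos (inv_lt_zero.2 (sub_neg.2 hlt))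
    (inv_pos.2 (sub_pos.2 hlt))) (Finset.prod_pos fun t ht => ?_)
  simp only [Finset.mem_erase] at ht
  obtain ⟨htx', htx, hts⟩ := ht
  rcases lt_or_gt_of_ne htx with hbelow | habove
  · exact mul_pos (inv_pos.2 (sub_pos.2 hbelow)) (inv_pos.2 (sub_pos.2 (hbelow.trans hlt)))
  · exact mul_pos_of_neg_of_neg (inv_lt_zero.2 (sub_neg.2 habove))
      (inv_lt_zero.2 (sub_neg.2 ((hnext t hts habove).lt_of_ne' htx')))

lemma exists_eval_secularPolynomial_mul_neg (hp : ∀ t ∈ s, 0 < p t) (hx : x ∈ s) :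
    ∃ b, x < b ∧ (∀ t ∈ s, x < t → b ≤ t) ∧
      (secularPolynomial s p).eval x * (secularPolynomial s p).eval b < 0 := by
  by_cases! hmax : ∀ t ∈ s, t ≤ x
  · have eval_neg : (secularPolynomial s p).eval x < 0 := by
      rw [eval_secularPolynomial_node hx, neg_lt_zero]
      exact div_pos (hp x hx) (nodalWeight_pos_of_forall_le hmax)
    have eval_atTop : Tendsto (fun t => (secularPolynomial s p).eval t) atTop atTop := by
      refine Polynomial.tendsto_atTop_of_leadingCoeff_nonneg _ ?_ ?_
      · rw [degree_secularPolynomial]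
        exact_mod_cast Finset.card_pos.2 ⟨x, hx⟩
      · simp [(monic_secularPolynomial s p).leadingCoeff]
    obtain ⟨b, hbpos, hxb⟩ :=
      ((eval_atTop.eventually_gt_atTop 0).and (eventually_gt_atTop x)).exists
    exact ⟨b, hxb, fun t ht hxt => absurd hxt (hmax t ht).not_gt,
      mul_neg_of_neg_of_pos eval_neg hbpos⟩
  · obtain ⟨t, ht⟩ := hmax
    obtain ⟨b, hb⟩ := (s.filter (x < ·)).exists_minimal ⟨t, Finset.mem_filter.2 ht⟩
    obtain ⟨hbs, hxb⟩ := Finset.mem_filter.1 hb.prop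
    have hnext : ∀ t ∈ s, x < t → b ≤ t := fun t hts hxt =>
      le_of_not_gt fun htb => (hb.not_prop_of_lt htb) (Finset.mem_filter.2 ⟨hts, hxt⟩)
    refine ⟨b, hxb, hnext, ?_⟩
    rw [eval_secularPolynomial_node hx, eval_secularPolynomial_node hbs, neg_mul_neg,
      div_mul_div_comm]
    exact div_neg_of_pos_of_neg (mul_pos (hp x hx) (hp b hbs))
      (nodalWeight_mul_nodalWeight_neg hx hbs hxb hnext)

lemma exists_isRoot_secularPolynomial (hp : ∀ t ∈ s, 0 < p t) (hx : x ∈ s) :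
    ∃ y, x < y ∧ (∀ t ∈ s, x < t → y < t) ∧ (secularPolynomial s p).IsRoot y := by
  obtain ⟨b, hxb, hnext, hsign⟩ := exists_eval_secularPolynomial_mul_neg hp hx
  have hcont := (secularPolynomial s p).continuousOn (s := Set.Icc x b)
  obtain ⟨y, hy, hroot⟩ : 0 ∈ (fun t => (secularPolynomial s p).eval t) '' Set.Ioo x b := by
    rcases mul_neg_iff.1 hsign with ⟨hpos, hneg⟩ | ⟨hneg, hpos⟩
    · exact intermediate_value_Ioo' hxb.le hcont ⟨hneg, hpos⟩
    · exact intermediate_value_Ioo hxb.le hcont ⟨hneg, hpos⟩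
  exact ⟨y, hy.1, fun t ht hxt => hy.2.trans_le (hnext t ht hxt), hroot⟩

lemma exists_interlaces_nodeResidue_eq (hp : ∀ x ∈ s, 0 < p x) :
    ∃ y, Interlaces s y ∧ ∀ x ∈ s, nodeResidue s id y x = p x := by
  choose! y hlt hnext hroot using fun x hx => exists_isRoot_secularPolynomial (x := x) hp hx
  refine ⟨y, fun x hx => ⟨(hlt x hx).le, fun t ht h => (hnext x hx t ht h).le⟩,
    fun x => nodeResidue_eq_of_secularPolynomial_eq_nodal ?_⟩
  have strictMonoOn : StrictMonoOn y s := fun a ha b hb hab =>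
    (hnext a ha b hb hab).trans (hlt b hb)
  refine Polynomial.eq_of_degree_le_of_eval_index_eq s strictMonoOn.injOn
    (degree_secularPolynomial s p).le ?_ ?_ fun x hx => ?_
  · rw [degree_secularPolynomial, Lagrange.degree_nodal]
  · rw [(monic_secularPolynomial s p).leadingCoeff, Lagrange.nodal_monic.leadingCoeff]
  · rw [hroot x hx, Lagrange.eval_nodal_at_node hx]

end Interlacing

/-- The measure with mass `p x` (cut off at `0` where `p` is negative) at each `x ∈ s`. -/
noncomputable def discreteMeasure {α : Type*} [MeasurableSpace α] (s : Finset α) (p : α → ℝ) :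
    Measure α :=
  ∑ x ∈ s, ENNReal.ofReal (p x) • Measure.dirac x

/-- Lebesgue measure on the intervals `[x, y x)`, `x ∈ s`, counted with multiplicity where these
overlap. -/
noncomputable def intervalMeasure (s : Finset ℝ) (y : ℝ → ℝ) : Measure ℝ :=
  ∑ x ∈ s, volume.restrict (Set.Ico x (y x))

section DiscreteMeasure

variable {α : Type*} [MeasurableSpace α] {s : Finset α} {p p' : α → ℝ}

lemma discreteMeasure_congr (h : ∀ x ∈ s, p x = p' x) :
    discreteMeasure s p = discreteMeasure s p' :=
  Finset.sum_congr rfl fun x hx => by rw [h x hx]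

lemma discreteMeasure_filter_pos (s : Finset α) (p : α → ℝ) :
    discreteMeasure (s.filter (0 < p ·)) p = discreteMeasure s p :=
  Finset.sum_filter_of_ne fun x _ hne => by
    contrapose! hne
    rw [ENNReal.ofReal_of_nonpos hne, zero_smul]

lemma isProbabilityMeasure_discreteMeasure_iff (hp : ∀ x ∈ s, 0 ≤ p x) :
    IsProbabilityMeasure (discreteMeasure s p) ↔ ∑ x ∈ s, p x = 1 := by
  have mass_eq : discreteMeasure s p Set.univ = ENNReal.ofReal (∑ x ∈ s, p x) := by
    simp [discreteMeasure, ENNReal.ofReal_sum_of_nonneg hp]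
  rw [isProbabilityMeasure_iff, mass_eq, ENNReal.ofReal_eq_one]

lemma ae_discreteMeasure_of_forall_mem [MeasurableSingletonClass α] {P : α → Prop}
    (h : ∀ x ∈ s, P x) : ∀ᵐ x ∂discreteMeasure s p, P x := by
  rw [discreteMeasure, ae_finsetSum_measure_iff]
  intro x hx
  exact Measure.ae_smul_measure (by simpa using h x hx) _

lemma integral_discreteMeasure [MeasurableSingletonClass α] {E : Type*} [NormedAddCommGroup E]
    [NormedSpace ℝ E] [CompleteSpace E] (hp : ∀ x ∈ s, 0 ≤ p x) (f : α → E) :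
    ∫ x, f x ∂discreteMeasure s p = ∑ x ∈ s, p x • f x := by
  rw [discreteMeasure, integral_finsetSum_measure fun x _ =>
    (integrable_dirac (by simp)).smul_measure ENNReal.ofReal_ne_top]
  refine Finset.sum_congr rfl fun x hx => ?_
  rw [integral_smul_measure, integral_dirac, ENNReal.toReal_ofReal (hp x hx)]

lemma eq_discreteMeasure_of_ae_mem [MeasurableSingletonClass α] {ρ : Measure α} [IsFiniteMeasure ρ]
    (hρ : ∀ᵐ x ∂ρ, x ∈ s) : ρ = discreteMeasure s fun x => ρ.real {x} := by
  classical
  refine Measure.ext fun A hA => ?_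
  calc ρ A = ρ ↑(s.filter (· ∈ A)) := measure_congr <| eventuallyEq_set.2 <|
        hρ.mono fun x hx => by simp [hx]
    _ = ∑ x ∈ s.filter (· ∈ A), ρ {x} := sum_measure_singleton.symm
    _ = discreteMeasure s (fun x => ρ.real {x}) A := by
        simp [discreteMeasure, Finset.sum_filter, Set.indicator_apply, hA]

end DiscreteMeasure

section IntervalMeasure

variable {s : Finset ℝ} {y : ℝ → ℝ} {R : ℝ} {z : ℂ}

lemma Interlaces.intervalMeasure_le_volume (h : Interlaces s y) : intervalMeasure s y ≤ volume := by
  refine Measure.le_iff.2 fun A hA => ?_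
  simp only [intervalMeasure, Measure.coe_finsetSum, Finset.sum_apply, Measure.restrict_apply hA]
  rw [← measure_biUnion_finset (h.pairwiseDisjoint_Ico.mono fun _ => Set.inter_subset_right)
    fun _ _ => hA.inter measurableSet_Ico]
  exact measure_mono (Set.iUnion₂_subset fun _ _ => Set.inter_subset_left)

lemma Interlaces.isProbabilityMeasure_intervalMeasure (h : Interlaces s y)
    (hsum : ∑ x ∈ s, (y x - x) = 1) : IsProbabilityMeasure (intervalMeasure s y) := by
  constructor
  simp only [intervalMeasure, Measure.coe_finsetSum, Finset.sum_apply, Measure.restrict_apply_univ,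
    Real.volume_Ico]
  rw [← ENNReal.ofReal_sum_of_nonneg fun x hx => sub_nonneg.2 (h x hx).1, hsum, ENNReal.ofReal_one]

lemma ae_intervalMeasure_of_forall_mem {P : ℝ → Prop}
    (h : ∀ x ∈ s, ∀ t ∈ Set.Ico x (y x), P t) : ∀ᵐ t ∂intervalMeasure s y, P t := by
  rw [intervalMeasure, ae_finsetSum_measure_iff]
  exact fun x hx => ae_restrict_of_forall_mem measurableSet_Ico (h x hx)

lemma exp_neg_setIntegral_stieltjesKernel_Ico {a b : ℝ} (ha : |a| ≤ R) (hb : |b| ≤ R)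
    (hab : a ≤ b) (hz : ‖z‖ * R < 1) :
    Complex.exp (-∫ x in Set.Ico a b, stieltjesKernel z x) =
      (1 - (b : ℂ) * z) / (1 - (a : ℂ) * z) := by
  have subset_Icc : Set.uIcc a b ⊆ Set.Icc (-R) R :=
    Set.uIcc_subset_Icc (abs_le.1 ha) (abs_le.1 hb)
  have antideriv : ∀ x ∈ Set.uIcc a b,
      HasDerivAt (fun x : ℝ => -Complex.log (1 - (x : ℂ) * z)) (stieltjesKernel z x) x := by
    intro x hx
    have inner_deriv : HasDerivAt (fun x : ℝ => 1 - (x : ℂ) * z) (-z) x := by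
      simpa using ((Complex.ofRealCLM.hasDerivAt (x := x)).mul_const z).const_sub 1
    have := (inner_deriv.clog_real
      (one_sub_ofReal_mul_mem_slitPlane (abs_le.2 (subset_Icc hx)) hz)).neg
    rwa [neg_div, neg_neg] at this
  have intervalIntegrable : IntervalIntegrable (stieltjesKernel z) volume a b :=
    ((continuousOn_stieltjesKernel hz).mono subset_Icc).intervalIntegrable
  rw [integral_Ico_eq_integral_Ioc, ← intervalIntegral.integral_of_le hab,
    intervalIntegral.integral_eq_sub_of_hasDerivAt antideriv intervalIntegrable, neg_sub,
    sub_neg_eq_add, neg_add_eq_sub, Complex.exp_sub,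
    Complex.exp_log (one_sub_ofReal_mul_ne_zero hb hz),
    Complex.exp_log (one_sub_ofReal_mul_ne_zero ha hz)]

lemma Interlaces.exp_neg_stieltjesTransform_intervalMeasure (h : Interlaces s y)
    (hs : ∀ x ∈ s, |x| ≤ R) (hy : ∀ x ∈ s, |y x| ≤ R) (hz : ‖z‖ * R < 1) :
    Complex.exp (-stieltjesTransform (intervalMeasure s y) z) =
      1 - stieltjesTransform (discreteMeasure s (nodeResidue s id y)) z := by
  have integrableOn : ∀ x ∈ s, IntegrableOn (stieltjesKernel z) (Set.Ico x (y x)) := fun x hx =>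
    ((continuousOn_stieltjesKernel hz).integrableOn_Icc).mono_set <|
      Set.Ico_subset_Icc_self.trans <| Set.Icc_subset_Icc (abs_le.1 (hs x hx)).1
        (abs_le.1 (hy x hx)).2
  calc Complex.exp (-stieltjesTransform (intervalMeasure s y) z)
      = ∏ x ∈ s, Complex.exp (-∫ t in Set.Ico x (y x), stieltjesKernel z t) := by
        rw [stieltjesTransform, intervalMeasure, integral_finsetSum_measure integrableOn,
          ← Finset.sum_neg_distrib, Complex.exp_sum]
    _ = ∏ x ∈ s, (1 - (y x : ℂ) * z) / (1 - (x : ℂ) * z) :=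
        Finset.prod_congr rfl fun x hx =>
          exp_neg_setIntegral_stieltjesKernel_Ico (hs x hx) (hy x hx) (h x hx).1 hz
    _ = 1 - stieltjesTransform (discreteMeasure s (nodeResidue s id y)) z := by
        rw [← one_sub_sum_nodeResidue_mul_stieltjesKernel y
          fun x hx => one_sub_ofReal_mul_ne_zero (hs x hx) hz, stieltjesTransform,
          integral_discreteMeasure fun x hx => h.nodeResidue_nonneg hx]
        simp only [Complex.real_smul]

end IntervalMeasure

/-- The largest multiple of the mesh `δ` that does not exceed `x`. -/
noncomputable def gridFloor (δ x : ℝ) : ℝ := ⌊x / δ⌋ * δ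

/-- The values of `gridFloor δ` on `[-R, R]`. -/
noncomputable def gridPoints (δ R : ℝ) : Finset ℝ :=
  (Finset.Icc ⌊-R / δ⌋ ⌊R / δ⌋).image fun n : ℤ => n * δ

section Grid

variable {δ R a b x : ℝ}

lemma gridFloor_le (hδ : 0 < δ) (x : ℝ) : gridFloor δ x ≤ x :=
  sub_nonneg.1 (Int.sub_floor_div_mul_nonneg x hδ)

lemma lt_gridFloor_add (hδ : 0 < δ) (x : ℝ) : x < gridFloor δ x + δ :=
  sub_lt_iff_lt_add'.1 (Int.sub_floor_div_mul_lt x hδ)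

lemma abs_gridFloor_sub_le (hδ : 0 < δ) (x : ℝ) : |gridFloor δ x - x| ≤ δ := by
  rw [abs_sub_comm, abs_of_nonneg (sub_nonneg.2 (gridFloor_le hδ x)), sub_le_iff_le_add']
  exact (lt_gridFloor_add hδ x).le

lemma measurable_gridFloor (δ : ℝ) : Measurable (gridFloor δ) := by
  unfold gridFloor
  fun_prop

lemma gridFloor_mem_gridPoints (hδ : 0 < δ) (hx : |x| ≤ R) : gridFloor δ x ∈ gridPoints δ R := by
  obtain ⟨hlower, hupper⟩ := abs_le.1 hx
  exact Finset.mem_image_of_mem _ <| Finset.mem_Icc.2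
    ⟨Int.floor_mono (by gcongr), Int.floor_mono (by gcongr)⟩

lemma abs_le_of_mem_gridPoints (hδ : 0 < δ) (ha : a ∈ gridPoints δ R) : |a| ≤ R + δ := by
  obtain ⟨n, hn, rfl⟩ := Finset.mem_image.1 ha
  obtain ⟨hlower, hupper⟩ := Finset.mem_Icc.1 hn
  have lower : (⌊-R / δ⌋ : ℝ) * δ ≤ n * δ := by gcongr
  have upper : n * δ ≤ (⌊R / δ⌋ : ℝ) * δ := by gcongr
  have := lt_gridFloor_add hδ (-R)
  have := gridFloor_le hδ R
  simp only [gridFloor] at *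
  exact abs_le.2 ⟨by linarith, by linarith⟩

lemma abs_gridFloor_le (hδ : 0 < δ) (hδ1 : δ ≤ 1) (hx : |x| ≤ R) :
    |gridFloor δ x| ≤ R + 1 :=
  (abs_le_of_mem_gridPoints hδ (gridFloor_mem_gridPoints hδ hx)).trans (by linarith)

lemma gridFloor_eq_of_mem_Ico (ha : a ∈ gridPoints δ R) (hx : x ∈ Set.Ico a (a + δ)) :
    gridFloor δ x = a := by
  obtain ⟨n, -, rfl⟩ := Finset.mem_image.1 ha
  have hδ : 0 < δ := by linarith [hx.1, hx.2]
  rw [gridFloor, Int.floor_eq_iff.2]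
  rw [le_div_iff₀ hδ, div_lt_iff₀ hδ, add_one_mul]
  exact hx

lemma add_le_of_lt_of_mem_gridPoints (hδ : 0 < δ) (ha : a ∈ gridPoints δ R)
    (hb : b ∈ gridPoints δ R) (hab : a < b) : a + δ ≤ b := by
  by_contra! hlt
  have := gridFloor_eq_of_mem_Ico ha ⟨hab.le, hlt⟩
  rw [gridFloor_eq_of_mem_Ico hb ⟨le_rfl, lt_add_of_pos_right b hδ⟩] at this
  exact hab.ne' this

variable {y : ℝ → ℝ}

lemma interlaces_gridPoints (hδ : 0 < δ) (hy : ∀ a ∈ gridPoints δ R, y a ∈ Set.Icc a (a + δ)) :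
    Interlaces (gridPoints δ R) y := fun a ha =>
  ⟨(hy a ha).1, fun _ hb hab => (hy a ha).2.trans (add_le_of_lt_of_mem_gridPoints hδ ha hb hab)⟩

lemma map_gridFloor_intervalMeasure (hy : ∀ a ∈ gridPoints δ R, y a ∈ Set.Icc a (a + δ)) :
    (intervalMeasure (gridPoints δ R) y).map (gridFloor δ) =
      discreteMeasure (gridPoints δ R) fun a => y a - a := by
  rw [intervalMeasure, Measure.map_finset_sum (measurable_gridFloor δ).aemeasurable,
    discreteMeasure]
  refine Finset.sum_congr rfl fun a ha => ?_
  have gridFloor_eq : gridFloor δ =ᵐ[volume.restrict (Set.Ico a (y a))] fun _ => a :=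
    ae_restrict_of_forall_mem measurableSet_Ico fun t ht =>
      gridFloor_eq_of_mem_Ico ha ⟨ht.1, ht.2.trans_le (hy a ha).2⟩
  rw [Measure.map_congr gridFloor_eq, Measure.map_const, Measure.restrict_apply_univ,
    Real.volume_Ico]

lemma map_gridFloor_eq_discreteMeasure {ρ : Measure ℝ} [IsFiniteMeasure ρ] (hδ : 0 < δ)
    (hρ : ∀ᵐ x ∂ρ, |x| ≤ R) :
    ρ.map (gridFloor δ) =
      discreteMeasure (gridPoints δ R) fun a => (ρ.map (gridFloor δ)).real {a} :=
  eq_discreteMeasure_of_ae_mem <|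
    (ae_map_iff (measurable_gridFloor δ).aemeasurable (gridPoints δ R).measurableSet).2 <|
      hρ.mono fun _ => gridFloor_mem_gridPoints hδ

lemma measureReal_map_gridFloor_singleton_le {ρ : Measure ℝ} (hδ : 0 < δ) (hρ : ρ ≤ volume)
    (a : ℝ) : (ρ.map (gridFloor δ)).real {a} ≤ δ := by
  have fiber_subset : gridFloor δ ⁻¹' {a} ⊆ Set.Ico a (a + δ) := by
    rintro x rfl
    exact ⟨gridFloor_le hδ x, lt_gridFloor_add hδ x⟩
  rw [map_measureReal_apply (measurable_gridFloor δ) (measurableSet_singleton a)]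
  refine ENNReal.toReal_le_of_le_ofReal hδ.le ?_
  simpa using (hρ _).trans (measure_mono fiber_subset)

end Grid

/-- `ν` is the image of `μ` under the Markov–Krein correspondence for `q = 1`. Fixing the interval
`[-R, R]` and the disc `‖z‖ * R < 1` makes the relation stable under weak limits. -/
structure IsMarkovKreinPair (R : ℝ) (μ ν : Measure ℝ) : Prop where
  le_volume : μ ≤ volume
  ae_abs_le_left : ∀ᵐ x ∂μ, |x| ≤ R
  ae_abs_le_right : ∀ᵐ x ∂ν, |x| ≤ R
  exp_neg_stieltjesTransform : ∀ z : ℂ, ‖z‖ * R < 1 →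
    Complex.exp (-stieltjesTransform μ z) = 1 - stieltjesTransform ν z

section MarkovKreinPair

variable {R δ : ℝ}

lemma IsMarkovKreinPair.markovKreinRel {μ ν : Measure ℝ} [IsFiniteMeasure μ] [IsFiniteMeasure ν]
    (h : IsMarkovKreinPair R μ ν) : MarkovKreinRel 1 μ ν := by
  rw [markovKreinRel_iff (isCompact_support_of_ae_abs_le h.ae_abs_le_left)
    (isCompact_support_of_ae_abs_le h.ae_abs_le_right)]
  filter_upwards [eventually_norm_mul_lt_one R] with z hz
  simpa using h.exp_neg_stieltjesTransform z hz

lemma exists_subseq_tendsto_isMarkovKreinPair {μ ν : ℕ → ProbabilityMeasure ℝ}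
    (h : ∀ n, IsMarkovKreinPair R (μ n) (ν n)) :
    ∃ (μ' ν' : ProbabilityMeasure ℝ) (φ : ℕ → ℕ), StrictMono φ ∧ Tendsto (μ ∘ φ) atTop (𝓝 μ') ∧
      Tendsto (ν ∘ φ) atTop (𝓝 ν') ∧ IsMarkovKreinPair R μ' ν' := by
  have mem_Icc {ρ : Measure ℝ} : (∀ᵐ x ∂ρ, |x| ≤ R) ↔ ∀ᵐ x ∂ρ, x ∈ Set.Icc (-R) R := by
    simp only [abs_le, Set.mem_Icc]
  obtain ⟨μ', φ, hφ, hμ, hμR⟩ := exists_subseq_tendsto_of_ae_mem isCompact_Icc μ fun n =>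
    mem_Icc.1 (h n).ae_abs_le_left
  obtain ⟨ν', ψ, hψ, hν, hνR⟩ := exists_subseq_tendsto_of_ae_mem isCompact_Icc (ν ∘ φ) fun n =>
    mem_Icc.1 (h (φ n)).ae_abs_le_right
  replace hμ := hμ.comp hψ.tendsto_atTop
  refine ⟨μ', ν', φ ∘ ψ, hφ.comp hψ, hμ, hν, le_of_tendsto_probabilityMeasure hμ fun n =>
    (h _).le_volume, mem_Icc.2 hμR, mem_Icc.2 hνR, fun z hz => ?_⟩
  have left_lim := (tendsto_stieltjesTransform hμ (fun n => (h _).ae_abs_le_left)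
    (mem_Icc.2 hμR) hz).neg.cexp
  have right_lim := (tendsto_stieltjesTransform hν (fun n => (h _).ae_abs_le_right)
    (mem_Icc.2 hνR) hz).const_sub 1
  exact tendsto_nhds_unique left_lim <|
    right_lim.congr fun n => ((h _).exp_neg_stieltjesTransform z hz).symm

lemma eq_of_tendsto_of_tendsto_stieltjesTransform {ι : Type*} {L : Filter ι} [L.NeBot]
    {ρ : ι → ProbabilityMeasure ℝ} {σ τ : ProbabilityMeasure ℝ} (hlim : Tendsto ρ L (𝓝 σ))
    (hρ : ∀ i, ∀ᵐ x ∂(ρ i : Measure ℝ), |x| ≤ R) (hσ : ∀ᵐ x ∂(σ : Measure ℝ), |x| ≤ R)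
    (hτ : ∀ᵐ x ∂(τ : Measure ℝ), |x| ≤ R)
    (h : ∀ z : ℂ, ‖z‖ * R < 1 →
      Tendsto (fun i => stieltjesTransform (ρ i) z) L (𝓝 (stieltjesTransform τ z))) :
    σ = τ := by
  suffices (σ : Measure ℝ) = τ from Subtype.ext this
  refine ext_of_stieltjesTransform_eventuallyEq (isCompact_support_of_ae_abs_le hσ)
    (isCompact_support_of_ae_abs_le hτ) ?_
  filter_upwards [eventually_norm_mul_lt_one R] with z hz
  exact tendsto_nhds_unique (tendsto_stieltjesTransform hlim hρ hσ hz) (h z hz)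

lemma Interlaces.exists_isMarkovKreinPair {s : Finset ℝ} {y : ℝ → ℝ} (h : Interlaces s y)
    (hsum : ∑ x ∈ s, (y x - x) = 1) (hs : ∀ x ∈ s, |x| ≤ R) :
    ∃ μ ν : ProbabilityMeasure ℝ, (μ : Measure ℝ) = intervalMeasure s y ∧
      (ν : Measure ℝ) = discreteMeasure s (nodeResidue s id y) ∧ IsMarkovKreinPair (R + 1) μ ν := by
  have hs' : ∀ x ∈ s, |x| ≤ R + 1 := fun x hx => (hs x hx).trans (by linarith)
  have hy : ∀ x ∈ s, |y x| ≤ R + 1 := fun x hx => by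
    obtain ⟨hlower, hupper⟩ := abs_le.1 (hs x hx)
    have := (h x hx).1
    have := h.le_add_of_sum_sub_le hsum.le hx
    exact abs_le.2 ⟨by linarith, by linarith⟩
  refine ⟨⟨_, h.isProbabilityMeasure_intervalMeasure hsum⟩,
    ⟨_, (isProbabilityMeasure_discreteMeasure_iff fun x => h.nodeResidue_nonneg).2 ?_⟩, rfl, rfl,
    h.intervalMeasure_le_volume,
    ae_intervalMeasure_of_forall_mem fun x hx t ht => ?_,
    ae_discreteMeasure_of_forall_mem hs',
    fun z => h.exp_neg_stieltjesTransform_intervalMeasure hs' hy⟩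
  · rw [sum_nodeResidue Function.injective_id.injOn, ← hsum]
    rfl
  · exact abs_le.2 ⟨(abs_le.1 (hs' x hx)).1.trans ht.1, ht.2.le.trans (abs_le.1 (hy x hx)).2⟩

lemma norm_stieltjesTransform_sub_le_of_map_gridFloor_eq {ρ σ : Measure ℝ} [IsProbabilityMeasure ρ]
    [IsProbabilityMeasure σ] {z : ℂ} (hδ : 0 < δ) (hρ : ∀ᵐ x ∂ρ, |x| ≤ R)
    (hσ : ∀ᵐ x ∂σ, |x| ≤ R) (hfloor : ∀ᵐ x ∂σ, |gridFloor δ x| ≤ R)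
    (h : ρ.map (gridFloor δ) = σ.map (gridFloor δ)) (hz : ‖z‖ * R < 1) :
    ‖stieltjesTransform ρ z - stieltjesTransform σ z‖ ≤ 2 * ((‖z‖ / (1 - ‖z‖ * R)) ^ 2 * δ) := by
  have meas := measurable_gridFloor δ
  have hfloor' : ∀ᵐ x ∂ρ, |gridFloor δ x| ≤ R := by
    rwa [← ae_map_abs_le_iff meas, h, ae_map_abs_le_iff meas]
  have near_ρ := norm_stieltjesTransform_map_sub_le meas hρ hfloor'
    (.of_forall (abs_gridFloor_sub_le hδ)) hz
  have near_σ := norm_stieltjesTransform_map_sub_le meas hσ hfloor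
    (.of_forall (abs_gridFloor_sub_le hδ)) hz
  rw [probReal_univ, mul_one] at near_ρ near_σ
  rw [h, norm_sub_rev] at near_ρ
  rw [two_mul]
  exact (norm_sub_le_norm_sub_add_norm_sub _ _ _).trans (add_le_add near_ρ near_σ)

lemma exists_isMarkovKreinPair_near_left {μ : ProbabilityMeasure ℝ} (hμ : (μ : Measure ℝ) ≤ volume)
    (hR : ∀ᵐ x ∂(μ : Measure ℝ), |x| ≤ R) (hδ : 0 < δ) (hδ1 : δ ≤ 1) :
    ∃ μ' ν' : ProbabilityMeasure ℝ, IsMarkovKreinPair (R + 2) μ' ν' ∧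
      ∀ z : ℂ, ‖z‖ * (R + 2) < 1 → ‖stieltjesTransform μ' z - stieltjesTransform μ z‖ ≤
        2 * ((‖z‖ / (1 - ‖z‖ * (R + 2))) ^ 2 * δ) := by
  set w : ℝ → ℝ := fun a => ((μ : Measure ℝ).map (gridFloor δ)).real {a}
  have hy : ∀ a ∈ gridPoints δ R, a + w a ∈ Set.Icc a (a + δ) := fun a _ =>
    ⟨le_add_of_nonneg_right measureReal_nonneg,
      add_le_add_right (measureReal_map_gridFloor_singleton_le hδ hμ a) a⟩
  have map_eq := map_gridFloor_eq_discreteMeasure hδ hR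
  have hsum : ∑ a ∈ gridPoints δ R, (a + w a - a) = 1 := by
    simp only [add_sub_cancel_left]
    rw [← isProbabilityMeasure_discreteMeasure_iff fun a _ => measureReal_nonneg, ← map_eq]
    exact Measure.isProbabilityMeasure_map (measurable_gridFloor δ).aemeasurable
  obtain ⟨μ', ν', hμ', -, pair⟩ := (interlaces_gridPoints hδ hy).exists_isMarkovKreinPair
    (R := R + 1) hsum fun a ha => (abs_le_of_mem_gridPoints hδ ha).trans (by gcongr)
  rw [add_assoc, one_add_one_eq_two] at pair
  refine ⟨μ', ν', pair, fun z => norm_stieltjesTransform_sub_le_of_map_gridFloor_eq hδ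
    pair.ae_abs_le_left (hR.mono fun x hx => by linarith)
    (hR.mono fun x hx => by linarith [abs_gridFloor_le hδ hδ1 hx]) ?_⟩
  rw [hμ', map_gridFloor_intervalMeasure hy, map_eq]
  exact discreteMeasure_congr fun a _ => add_sub_cancel_left _ _

lemma exists_isMarkovKreinPair_near_right {ν : ProbabilityMeasure ℝ}
    (hR : ∀ᵐ x ∂(ν : Measure ℝ), |x| ≤ R) (hδ : 0 < δ) (hδ1 : δ ≤ 1) :
    ∃ μ' ν' : ProbabilityMeasure ℝ, IsMarkovKreinPair (R + 2) μ' ν' ∧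
      ∀ z : ℂ, ‖z‖ * (R + 2) < 1 → ‖stieltjesTransform ν' z - stieltjesTransform ν z‖ ≤
        (‖z‖ / (1 - ‖z‖ * (R + 2))) ^ 2 * δ := by
  set w : ℝ → ℝ := fun a => ((ν : Measure ℝ).map (gridFloor δ)).real {a}
  set s := (gridPoints δ R).filter (0 < w ·)
  have pos : ∀ a ∈ s, 0 < w a := fun a ha => (Finset.mem_filter.1 ha).2
  have map_eq : (ν : Measure ℝ).map (gridFloor δ) = discreteMeasure s w := by
    rw [discreteMeasure_filter_pos, ← map_gridFloor_eq_discreteMeasure hδ hR]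
  obtain ⟨y, hy, residue_eq⟩ := exists_interlaces_nodeResidue_eq pos
  have hsum : ∑ a ∈ s, (y a - a) = 1 := by
    rw [← (isProbabilityMeasure_discreteMeasure_iff fun a ha => (pos a ha).le).1
      (map_eq ▸ Measure.isProbabilityMeasure_map (measurable_gridFloor δ).aemeasurable),
      ← Finset.sum_congr rfl residue_eq, sum_nodeResidue Function.injective_id.injOn]
    rfl
  obtain ⟨μ', ν', -, hν', pair⟩ := hy.exists_isMarkovKreinPair (R := R + 1) hsum
    fun a ha => (abs_le_of_mem_gridPoints hδ (Finset.mem_of_mem_filter a ha)).trans (by gcongr)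
  rw [add_assoc, one_add_one_eq_two] at pair
  rw [discreteMeasure_congr residue_eq, ← map_eq] at hν'
  refine ⟨μ', ν', pair, fun z hz => ?_⟩
  have near := norm_stieltjesTransform_map_sub_le (measurable_gridFloor δ)
    (hR.mono fun x hx => by linarith)
    (hR.mono fun x hx => by linarith [abs_gridFloor_le hδ hδ1 hx])
    (.of_forall (abs_gridFloor_sub_le hδ)) hz
  rwa [probReal_univ, mul_one, ← hν'] at near

lemma tendsto_of_norm_sub_le_mul_one_div_add_one {E : Type*} [SeminormedAddCommGroup E]
    {u : ℕ → E} {a : E} {C : ℝ} (h : ∀ n : ℕ, ‖u n - a‖ ≤ C * (1 / (n + 1))) :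
    Tendsto u atTop (𝓝 a) := by
  rw [tendsto_iff_norm_sub_tendsto_zero]
  refine squeeze_zero (fun _ => norm_nonneg _) h ?_
  simpa using tendsto_one_div_add_atTop_nhds_zero_nat.const_mul C

lemma exists_isMarkovKreinPair_of_le_volume {μ : ProbabilityMeasure ℝ}
    (hμ : (μ : Measure ℝ) ≤ volume) (hR : ∀ᵐ x ∂(μ : Measure ℝ), |x| ≤ R) :
    ∃ ν : ProbabilityMeasure ℝ, IsMarkovKreinPair (R + 2) μ ν := by
  choose μ' ν' pair near using fun n : ℕ =>
    exists_isMarkovKreinPair_near_left hμ hR Nat.one_div_pos_of_nat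
      (div_le_self zero_le_one (by simp))
  obtain ⟨μ'', ν, φ, hφ, hlim, -, limit_pair⟩ := exists_subseq_tendsto_isMarkovKreinPair pair
  obtain rfl : μ'' = μ := by
    refine eq_of_tendsto_of_tendsto_stieltjesTransform hlim (fun n => (pair (φ n)).ae_abs_le_left)
      limit_pair.ae_abs_le_left (hR.mono fun x hx => by linarith) fun z hz => ?_
    simp only [← mul_assoc] at near
    exact (tendsto_of_norm_sub_le_mul_one_div_add_one fun n => near n z hz).comp hφ.tendsto_atTop
  exact ⟨ν, limit_pair⟩

lemma exists_isMarkovKreinPair_of_ae_abs_le {ν : ProbabilityMeasure ℝ}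
    (hR : ∀ᵐ x ∂(ν : Measure ℝ), |x| ≤ R) :
    ∃ μ : ProbabilityMeasure ℝ, IsMarkovKreinPair (R + 2) μ ν := by
  choose μ' ν' pair near using fun n : ℕ =>
    exists_isMarkovKreinPair_near_right hR Nat.one_div_pos_of_nat
      (div_le_self zero_le_one (by simp))
  obtain ⟨μ, ν'', φ, hφ, -, hlim, limit_pair⟩ := exists_subseq_tendsto_isMarkovKreinPair pair
  obtain rfl : ν'' = ν := by
    refine eq_of_tendsto_of_tendsto_stieltjesTransform hlim (fun n => (pair (φ n)).ae_abs_le_right)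
      limit_pair.ae_abs_le_right (hR.mono fun x hx => by linarith) fun z hz => ?_
    exact (tendsto_of_norm_sub_le_mul_one_div_add_one fun n => near n z hz).comp hφ.tendsto_atTop
  exact ⟨μ, limit_pair⟩

end MarkovKreinPair

section Dilation

lemma ae_map_mul_left_abs_le {ρ : Measure ℝ} {R : ℝ} (c : ℝ) (hρ : ∀ᵐ x ∂ρ, |x| ≤ R) :
    ∀ᵐ x ∂ρ.map (c * ·), |x| ≤ |c| * R := by
  rw [ae_map_abs_le_iff (by fun_prop)]
  filter_upwards [hρ] with x hx
  rw [abs_mul]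
  gcongr

lemma mul_momentTerm_map_mul_left (c : ℝ) (ρ : Measure ℝ) (z : ℂ) (k : ℕ) :
    (c : ℂ) * momentTerm (ρ.map (c * ·)) z k = momentTerm ρ (c * z) k := by
  have moment_map : moment id k (ρ.map (c * ·)) = c ^ k * moment id k ρ := by
    simp only [moment, Pi.pow_apply, id]
    rw [integral_map (by fun_prop) (by fun_prop), ← integral_const_mul]
    simp only [mul_pow]
  rw [momentTerm, momentTerm, moment_map]
  push_cast
  ring

lemma MarkovKreinRel.map_mul_left {q : ℝ} (hq : q ≠ 0) {μ ν : Measure ℝ}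
    (h : MarkovKreinRel 1 μ ν) : MarkovKreinRel q (μ.map (q * ·)) (ν.map (q * ·)) := by
  have hq' : (q : ℂ) ≠ 0 := Complex.ofReal_ne_zero.2 hq
  have dilate_zero : Tendsto (fun z : ℂ => q * z) (𝓝 0) (𝓝 0) :=
    Continuous.tendsto' (by fun_prop) _ _ (mul_zero _)
  filter_upwards [dilate_zero.eventually h] with z hz
  simp only [← funext (mul_momentTerm_map_mul_left q _ z), summable_mul_left_iff hq', tsum_mul_left,
    Complex.ofReal_one, neg_one_mul, one_mul] at hz
  rwa [neg_mul]

lemma map_mul_left_le_smul_volume {c : ℝ} (hc : c ≠ 0) {μ : Measure ℝ} (hμ : μ ≤ volume) :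
    μ.map (c * ·) ≤ ENNReal.ofReal (1 / |c|) • (volume : Measure ℝ) := by
  refine (Measure.map_mono hμ (by fun_prop)).trans ?_
  rw [Real.map_volume_mul_left hc, abs_inv, one_div]

lemma map_inv_mul_left_le_volume {c : ℝ} (hc : c ≠ 0) {μ : Measure ℝ}
    (hμ : μ ≤ ENNReal.ofReal (1 / |c|) • (volume : Measure ℝ)) : μ.map (c⁻¹ * ·) ≤ volume := by
  refine (Measure.map_mono hμ (by fun_prop)).trans ?_
  rw [Measure.map_smul, Real.map_volume_mul_left (inv_ne_zero hc), inv_inv, smul_smul,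
    ← ENNReal.ofReal_mul (by positivity), one_div, inv_mul_cancel₀ (abs_ne_zero.2 hc),
    ENNReal.ofReal_one, one_smul]

lemma map_mul_left_map_inv_mul_left {c : ℝ} (hc : c ≠ 0) (ρ : Measure ℝ) :
    (ρ.map (c⁻¹ * ·)).map (c * ·) = ρ := by
  rw [Measure.map_map (by fun_prop) (by fun_prop)]
  simp [Function.comp_def, mul_inv_cancel_left₀ hc]

end Dilation

section Density

variable {α : Type*} {_ : MeasurableSpace α} {μ ν : Measure α} {c : ENNReal}

lemma le_smul_of_rnDeriv_le [μ.HaveLebesgueDecomposition ν] (hac : μ ≪ ν)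
    (h : ∀ᵐ x ∂ν, μ.rnDeriv ν x ≤ c) : μ ≤ c • ν := by
  rw [← Measure.withDensity_rnDeriv_eq μ ν hac, ← withDensity_const]
  exact withDensity_mono h

lemma rnDeriv_le_of_le_smul [SigmaFinite ν] (h : μ ≤ c • ν) : ∀ᵐ x ∂ν, μ.rnDeriv ν x ≤ c := by
  refine ae_le_of_forall_setLIntegral_le_of_sigmaFinite (Measure.measurable_rnDeriv _ _)
    fun s _ _ => ?_
  calc ∫⁻ x in s, μ.rnDeriv ν x ∂ν ≤ μ s := Measure.setLIntegral_rnDeriv_le s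
    _ ≤ (c • ν) s := h s
    _ = ∫⁻ _ in s, c ∂ν := by simp

end Density

instance (ν : CompactProb) : IsProbabilityMeasure ν.toMeasure :=
  inferInstanceAs (IsProbabilityMeasure (ν.1 : Measure ℝ))

instance {q : ℝ} (μ : BoundedDensityProb q) : IsProbabilityMeasure μ.toMeasure :=
  inferInstanceAs (IsProbabilityMeasure (μ.1 : Measure ℝ))

section Existence

variable {q : ℝ}

lemma BoundedDensityProb.exists_markovKreinRel (hq : q ≠ 0) (μ : BoundedDensityProb q) :
    ∃ ν : CompactProb, MarkovKreinRel q μ.toMeasure ν.toMeasure := by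
  obtain ⟨μ, hcompact, hac, hdensity⟩ := μ
  obtain ⟨R, -, hR⟩ := exists_ae_abs_le_of_isCompact_support hcompact
  obtain ⟨ν, pair⟩ := exists_isMarkovKreinPair_of_le_volume
    (μ := μ.map (f := (q⁻¹ * ·)) (by fun_prop))
    (map_inv_mul_left_le_volume hq (le_smul_of_rnDeriv_le hac hdensity))
    (ae_map_mul_left_abs_le q⁻¹ hR)
  refine ⟨⟨ν.map (f := (q * ·)) (by fun_prop), isCompact_support_of_ae_abs_le
    (ae_map_mul_left_abs_le q pair.ae_abs_le_right)⟩, ?_⟩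
  have rel := pair.markovKreinRel.map_mul_left hq
  rwa [ProbabilityMeasure.toMeasure_map, map_mul_left_map_inv_mul_left hq] at rel

lemma CompactProb.exists_markovKreinRel (hq : q ≠ 0) (ν : CompactProb) :
    ∃ μ : BoundedDensityProb q, MarkovKreinRel q μ.toMeasure ν.toMeasure := by
  obtain ⟨ν, hcompact⟩ := ν
  obtain ⟨R, -, hR⟩ := exists_ae_abs_le_of_isCompact_support hcompact
  obtain ⟨μ, pair⟩ := exists_isMarkovKreinPair_of_ae_abs_le
    (ν := ν.map (f := (q⁻¹ * ·)) (by fun_prop)) (ae_map_mul_left_abs_le q⁻¹ hR)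
  have hle := map_mul_left_le_smul_volume hq pair.le_volume
  refine ⟨⟨μ.map (f := (q * ·)) (by fun_prop), isCompact_support_of_ae_abs_le
    (ae_map_mul_left_abs_le q pair.ae_abs_le_left), Measure.absolutelyContinuous_of_le_smul hle,
    rnDeriv_le_of_le_smul hle⟩, ?_⟩
  have rel := pair.markovKreinRel.map_mul_left hq
  rwa [ProbabilityMeasure.toMeasure_map, map_mul_left_map_inv_mul_left hq] at rel

lemma CompactProb.eq_of_markovKreinRel (hq : q ≠ 0) {μ : BoundedDensityProb q}
    {ν ν' : CompactProb} (h : MarkovKreinRel q μ.toMeasure ν.toMeasure)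
    (h' : MarkovKreinRel q μ.toMeasure ν'.toMeasure) : ν = ν' :=
  have measure_eq : ν.toMeasure = ν'.toMeasure := h.right_unique hq μ.2.1 ν.2 ν'.2 h'
  Subtype.ext (Subtype.ext measure_eq)

lemma BoundedDensityProb.eq_of_markovKreinRel (hq : q ≠ 0) {μ μ' : BoundedDensityProb q}
    {ν : CompactProb} (h : MarkovKreinRel q μ.toMeasure ν.toMeasure)
    (h' : MarkovKreinRel q μ'.toMeasure ν.toMeasure) : μ = μ' :=
  have measure_eq : μ.toMeasure = μ'.toMeasure := h.left_unique hq μ.2.1 μ'.2.1 ν.2 h'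
  Subtype.ext (Subtype.ext measure_eq)

end Existence

theorem mainTheorem10 (q : ℝ) (hq : q ≠ 0) :
    (∀ μ : BoundedDensityProb q, ∃! ν : CompactProb, MarkovKreinRel q μ.toMeasure ν.toMeasure) ∧
    ∃ MK : BoundedDensityProb q → CompactProb,
      (∀ (μ : BoundedDensityProb q) (ν : CompactProb),
        MK μ = ν ↔ MarkovKreinRel q μ.toMeasure ν.toMeasure) ∧
      Function.Bijective MK := by
  choose MK hMK using BoundedDensityProb.exists_markovKreinRel hq
  have MK_eq_iff : ∀ (μ : BoundedDensityProb q) (ν : CompactProb),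
      MK μ = ν ↔ MarkovKreinRel q μ.toMeasure ν.toMeasure := fun μ ν =>
    ⟨fun h => h ▸ hMK μ, fun h => CompactProb.eq_of_markovKreinRel hq (hMK μ) h⟩
  refine ⟨fun μ => ⟨MK μ, hMK μ, fun ν h => ((MK_eq_iff μ ν).2 h).symm⟩, MK, MK_eq_iff, ?_, ?_⟩
  · intro μ μ' h
    exact BoundedDensityProb.eq_of_markovKreinRel hq (hMK μ) (h ▸ hMK μ')
  · intro ν
    obtain ⟨μ, hμ⟩ := CompactProb.exists_markovKreinRel hq ν
    exact ⟨μ, (MK_eq_iff μ ν).2 hμ⟩
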